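/- Let $n\in\mathbb{N}$ and $\mathbf{d}=(d_1,\ldots,d_n)$ with $d_j\in\mathbb{Z}_{\ge 0}$. A polynomial $p\in\mathbb{C}[z_1,\ldots,z_n]$ is called Lee-Yang if $p(z_1,\ldots,z_n)\neq 0$ whenever $|z_j|<1$ for all $j$, and whenever $|z_j|>1$ for all $j$. Let $\mathrm{LY}_{\mathbf{d}}(n)$ be the set of Lee-Yang polynomials in $n$ variables whose degree in $z_j$ is exactly $d_j$ for every $j$. For $p\in\mathrm{LY}_{\mathbf{d}}(n)$ and $\ell=(\ell_1,\ldots,\ell_n)\in\mathbb{R}^n$ with all $\ell_j>0$, let $$\mu_{p,\ell}=\sum_{x\in\Lambda}m(x)\,\delta_x,$$ where $\Lambda\subset\mathbb{R}$ is the set of real zeros of the entire function $f(x)=p(e^{ix\ell_1},\ldots,e^{ix\ell_n})$ and $m(x)$ is the multiplicity of $x$ as a zero of $f$. Write $|\mathbf{d}|=\sum_j d_j$ and $\langle\mathbf{d},\ell\rangle=\sum_j d_j\ell_j$. Theorem (density and maximal gap). Let $p\in\mathrm{LY}_{\mathbf{d}}(n)$ and let $\ell\in\mathbb{R}^n$ have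 all entries positive. Then: (1) For all $x\in\mathbb{R}$ and $T>0$, $\mu_{p,\ell}([x,x+T])$ is finite and $$\mu_{p,\ell}([x,x+T])=\frac{\langle\mathbf{d},\ell\rangle}{2\pi}\,T+\mathrm{err}(x,T),\qquad |\mathrm{err}(x,T)|\le|\mathbf{d}|.$$ (2) If $x<y$ are consecutive atoms of $\mu_{p,\ell}$ (both are atoms and there is no atom in the open interval $(x,y)$), then $$y-x\le 2\pi\,\frac{|\mathbf{d}|}{\langle\mathbf{d},\ell\rangle}.$$ -/

import Mathlib

open MeasureTheory
open scoped BigOperators ENNReal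

/-- A polynomial in `n` complex variables is Lee-Yang if it has no zeros with all coordinates in the
open unit disk, and no zeros with all coordinates outside the closed unit disk. -/
def IsLeeYang {n : ℕ} (p : MvPolynomial (Fin n) ℂ) : Prop :=
  (∀ z : Fin n → ℂ, (∀ j, ‖z j‖ < 1) → MvPolynomial.eval z p ≠ 0) ∧
  (∀ z : Fin n → ℂ, (∀ j, 1 < ‖z j‖) → MvPolynomial.eval z p ≠ 0)

/-- `LY n d` is the set of Lee-Yang polynomials in `n` variables whose degree in the `j`-th variable
is exactly `d j`, for every `j`. -/
def LY (n : ℕ) (d : Fin n → ℕ) : Set (MvPolynomial (Fin n) ℂ) :=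
  {p | IsLeeYang p ∧ ∀ j, MvPolynomial.degreeOf j p = d j}

/-- The exponential polynomial `f(x) = p(exp(i x ℓ₁), …, exp(i x ℓₙ))`, as an entire function. -/
noncomputable def expPoly {n : ℕ} (p : MvPolynomial (Fin n) ℂ) (l : Fin n → ℝ) (x : ℂ) : ℂ :=
  MvPolynomial.eval (fun j => Complex.exp (Complex.I * x * (l j : ℂ))) p

/-- The set of real zeros of the exponential polynomial `f(x) = p(exp(i x ℓ))`. -/
def zeroSet {n : ℕ} (p : MvPolynomial (Fin n) ℂ) (l : Fin n → ℝ) : Set ℝ :=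
  {x | expPoly p l (x : ℂ) = 0}

/-- The multiplicity of `x` as a zero of the exponential polynomial `f(x) = p(exp(i x ℓ))`. -/
noncomputable def zeroMult {n : ℕ} (p : MvPolynomial (Fin n) ℂ) (l : Fin n → ℝ) (x : ℝ) : ℕ∞ :=
  analyticOrderAt (expPoly p l) (x : ℂ)

/-- The measure `μ_{p,ℓ} = ∑_{x ∈ Λ} m(x) δ_x`, with `Λ` the set of zeros of `p(exp(i x ℓ))` and
`m(x)` their multiplicities. -/
noncomputable def zeroMeasure {n : ℕ} (p : MvPolynomial (Fin n) ℂ) (l : Fin n → ℝ) : Measure ℝ :=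
  Measure.sum fun x : zeroSet p l => (zeroMult p l (x : ℝ) : ℝ≥0∞) • Measure.dirac (x : ℝ)

/-- `x < y` are consecutive atoms of the measure `μ`. -/
def ConsecutiveAtoms (μ : Measure ℝ) (x y : ℝ) : Prop :=
  x < y ∧ μ {x} ≠ 0 ∧ μ {y} ≠ 0 ∧ ∀ t ∈ Set.Ioo x y, μ {t} = 0

/-!
The zeros of `f z = p (exp (i z ℓ))` are counted by following its argument along the real axis, once
from above and once from below.

For `Im z > 0` the point `w = exp (i z ℓ)` lies in the open polydisk, and so does the whole closed
disk of the complex line through `w`. On that disk `p` does not vanish, so the one-variable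
polynomial `t ↦ p (t w)` has all its roots `ρ` outside the closed unit disk, and
`∑ log (1 - ρ⁻¹)` is a logarithm of `p w / p 0` whose imaginary part is at most `|d| π / 2`, as there
are at most `|d|` roots. It equals the integral of the logarithmic derivative of `t ↦ p (t w)` over
`[0, 1]`, hence depends continuously on `z` (`exists_continuousOn_log`).

For `Im z < 0` the same applies to the reversed polynomial `w ^ d p (1 / w)`, which gives a
continuous logarithm of `exp (-i ⟨d, ℓ⟩ z) f z` with the same bound. This needs the reversed
polynomial not to vanish at the origin, i.e. that the monomial `z ^ d` occurs in `p`, a consequence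
of the absence of zeros outside the closed polydisk (`MvPolynomial.exists_top_monomial`).

Near `[a, b]` the function `f` is a product of linear factors `z - x` and a nonvanishing function,
which has a continuous logarithm across the real axis. Going from slightly left of `a` to slightly
right of `b`, each linear factor changes the argument by `-π` above the axis and by `π` below it.
Subtracting the two comparisons shows that `2 π` times the number of zeros is `⟨d, ℓ⟩ (b - a)` up to
four boundary terms of size at most `|d| π / 2`
(`abs_two_pi_mul_card_sub_le_of_factorization`), which is the density statement. An interval
without zeros can therefore have length at most `2 π |d| / ⟨d, ℓ⟩`.
-/

/-! ### Logarithms of polynomials without zeros in the closed unit disk -/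

/-- The sum of the principal values `log (1 - ρ⁻¹)` over the roots `ρ` of `Q`. When all roots lie
outside the closed unit disk this is the branch of `log (Q 1 / Q 0)` obtained by following `Q` along
the segment from `0` to `1`. -/
noncomputable def rootLogSum (Q : Polynomial ℂ) : ℂ :=
  (Q.roots.map fun ρ => Complex.log (1 - ρ⁻¹)).sum

lemma re_one_sub_pos {ρ : ℂ} (hρ : 1 < ‖ρ‖) {t : ℝ} (ht : t ∈ Set.Icc (0 : ℝ) 1) :
    0 < (1 - (t : ℂ) * ρ⁻¹).re := by
  have h1 : ‖(t : ℂ) * ρ⁻¹‖ < 1 := by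
    rw [norm_mul, norm_inv, Complex.norm_real, Real.norm_of_nonneg ht.1]
    have : ‖ρ‖⁻¹ < 1 := inv_lt_one_of_one_lt₀ hρ
    have h0 : 0 < ‖ρ‖⁻¹ := inv_pos.2 (by linarith)
    nlinarith [ht.1, ht.2]
  have h2 := (Complex.re_le_norm ((t : ℂ) * ρ⁻¹)).trans_lt h1
  rw [Complex.sub_re, Complex.one_re]
  linarith

lemma re_one_sub_inv_pos {ρ : ℂ} (hρ : 1 < ‖ρ‖) : 0 < (1 - ρ⁻¹).re := by
  simpa using re_one_sub_pos hρ (t := 1) (by simp)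

lemma one_lt_norm_of_mem_roots {Q : Polynomial ℂ} (hQ : ∀ s : ℂ, ‖s‖ ≤ 1 → Q.eval s ≠ 0)
    {ρ : ℂ} (hρ : ρ ∈ Q.roots) : 1 < ‖ρ‖ := by
  by_contra h
  exact hQ ρ (not_lt.1 h) (Polynomial.isRoot_of_mem_roots hρ)

lemma exp_rootLogSum_mul_eval_zero {Q : Polynomial ℂ} (hQ : ∀ s : ℂ, ‖s‖ ≤ 1 → Q.eval s ≠ 0) :
    Complex.exp (rootLogSum Q) * Q.eval 0 = Q.eval 1 := by
  have key : ∀ s : Multiset ℂ, (∀ ρ ∈ s, 1 < ‖ρ‖) →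
      Complex.exp (s.map fun ρ => Complex.log (1 - ρ⁻¹)).sum * (s.map fun ρ => 0 - ρ).prod =
        (s.map fun ρ => 1 - ρ).prod := by
    intro s
    induction s using Multiset.induction_on with
    | empty => simp
    | cons a s ih =>
      intro hs
      have ha : 1 < ‖a‖ := hs a (Multiset.mem_cons_self a s)
      have hne : (1 - a⁻¹ : ℂ) ≠ 0 := fun h => by
        have := re_one_sub_inv_pos ha
        simp [h] at this
      have ha0 : a ≠ 0 := fun h => by simp [h] at ha; linarith
      have := ih fun ρ hρ => hs ρ (Multiset.mem_cons_of_mem hρ)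
      simp only [Multiset.map_cons, Multiset.sum_cons, Multiset.prod_cons, Complex.exp_add,
        Complex.exp_log hne]
      rw [← this]
      field_simp
      ring
  have hsp := IsAlgClosed.splits Q
  rw [hsp.eval_eq_prod_roots 0, hsp.eval_eq_prod_roots 1,
    ← key _ fun ρ hρ => one_lt_norm_of_mem_roots hQ hρ, rootLogSum]
  ring

/-- Each root contributes an argument in `(-π/2, π/2)`. -/
lemma abs_im_rootLogSum_le {Q : Polynomial ℂ} (hQ : ∀ s : ℂ, ‖s‖ ≤ 1 → Q.eval s ≠ 0) :
    |(rootLogSum Q).im| ≤ Q.natDegree * (Real.pi / 2) := by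
  have key : ∀ s : Multiset ℂ, (∀ ρ ∈ s, 1 < ‖ρ‖) →
      |(s.map fun ρ => Complex.log (1 - ρ⁻¹)).sum.im| ≤ Multiset.card s * (Real.pi / 2) := by
    intro s
    induction s using Multiset.induction_on with
    | empty => simp
    | cons a s ih =>
      intro hs
      have ha : 1 < ‖a‖ := hs a (Multiset.mem_cons_self a s)
      have h1 := ih fun ρ hρ => hs ρ (Multiset.mem_cons_of_mem hρ)
      have h2 : |(Complex.log (1 - a⁻¹)).im| ≤ Real.pi / 2 := by
        rw [Complex.log_im]
        exact Complex.abs_arg_le_pi_div_two_iff.2 (re_one_sub_inv_pos ha).le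
      simp only [Multiset.map_cons, Multiset.sum_cons, Complex.add_im, Multiset.card_cons]
      push_cast
      have h3 := abs_add_le (Complex.log (1 - a⁻¹)).im
        (s.map fun ρ => Complex.log (1 - ρ⁻¹)).sum.im
      linarith
  rw [(IsAlgClosed.splits Q).natDegree_eq_card_roots]
  exact key _ fun ρ hρ => one_lt_norm_of_mem_roots hQ hρ

lemma rootLogSum_eq_integral {Q : Polynomial ℂ} (hQ : ∀ s : ℂ, ‖s‖ ≤ 1 → Q.eval s ≠ 0) :
    rootLogSum Q = ∫ t in (0 : ℝ)..1, Q.derivative.eval (t : ℂ) / Q.eval (t : ℂ) := by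
  have hnorm : ∀ t ∈ Set.Icc (0 : ℝ) 1, ‖(t : ℂ)‖ ≤ 1 := fun t ht => by
    rw [Complex.norm_real, Real.norm_of_nonneg ht.1]; exact ht.2
  have key : ∀ s : Multiset ℂ, (∀ ρ ∈ s, 1 < ‖ρ‖) → ∀ t ∈ Set.Icc (0 : ℝ) 1,
      HasDerivAt (fun t : ℝ => (s.map fun ρ => Complex.log (1 - (t : ℂ) * ρ⁻¹)).sum)
        (s.map fun ρ => 1 / ((t : ℂ) - ρ)).sum t := by
    intro s
    induction s using Multiset.induction_on with
    | empty => simp [hasDerivAt_const]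
    | cons a s ih =>
      intro hs t ht
      have ha : 1 < ‖a‖ := hs a (Multiset.mem_cons_self a s)
      have h1 := ih (fun ρ hρ => hs ρ (Multiset.mem_cons_of_mem hρ)) t ht
      have hpos := re_one_sub_pos ha ht
      have ha0 : a ≠ 0 := fun h => by simp [h] at ha; linarith
      have hta : (t : ℂ) - a ≠ 0 := fun h => by
        have := hnorm t ht
        rw [sub_eq_zero.1 h] at this
        linarith
      have h2 : HasDerivAt (fun t : ℝ => 1 - (t : ℂ) * a⁻¹) (-a⁻¹) t := by
        have := ((Complex.ofRealCLM.hasDerivAt (x := t)).mul_const a⁻¹).const_sub 1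
        simpa using this
      have h3 := (HasDerivAt.clog_real h2 (Or.inl hpos)).add h1
      simp only [Multiset.map_cons, Multiset.sum_cons]
      refine h3.congr_deriv ?_
      congr 1
      have h4 : 1 - (t : ℂ) * a⁻¹ ≠ 0 := fun h => by simp [h] at hpos
      rw [div_eq_div_iff h4 hta]
      field_simp
      ring
  have hr := fun ρ hρ => one_lt_norm_of_mem_roots hQ (ρ := ρ) hρ
  have hu : Set.uIcc (0 : ℝ) 1 = Set.Icc 0 1 := Set.uIcc_of_le zero_le_one
  have hI := intervalIntegral.integral_eq_sub_of_hasDerivAt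
    (f := fun t : ℝ => (Q.roots.map fun ρ => Complex.log (1 - (t : ℂ) * ρ⁻¹)).sum)
    (f' := fun t : ℝ => Q.derivative.eval (t : ℂ) / Q.eval (t : ℂ)) (a := 0) (b := 1)
    (fun t ht => by
      rw [hu] at ht
      rw [(IsAlgClosed.splits Q).eval_derivative_div_eval_of_ne_zero (hQ _ (hnorm t ht))]
      exact key _ hr t ht)
    (ContinuousOn.intervalIntegrable (by
      rw [hu]
      refine ContinuousOn.div ?_ ?_ fun t ht => hQ _ (hnorm t ht)
      · exact (Q.derivative.continuous.comp Complex.continuous_ofReal).continuousOn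
      · exact (Q.continuous.comp Complex.continuous_ofReal).continuousOn))
  rw [hI]
  simp [rootLogSum]

/-! ### A continuous logarithm of a multivariate polynomial with bounded argument -/

/-- The restriction `t ↦ q (t w)` of `q` to the complex line through `w`. -/
noncomputable def linePoly {n : ℕ} (q : MvPolynomial (Fin n) ℂ) (w : Fin n → ℂ) : Polynomial ℂ :=
  MvPolynomial.aeval (fun j => Polynomial.C (w j) * Polynomial.X) q

lemma eval_linePoly {n : ℕ} (q : MvPolynomial (Fin n) ℂ) (w : Fin n → ℂ) (s : ℂ) :
    (linePoly q w).eval s = MvPolynomial.eval (fun j => w j * s) q := by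
  induction q using MvPolynomial.induction_on with
  | C a => simp [linePoly]
  | add p q hp hq =>
    simp only [linePoly, map_add, Polynomial.eval_add] at *
    rw [hp, hq]
  | mul_X p j hp =>
    simp only [linePoly, map_mul, Polynomial.eval_mul, MvPolynomial.aeval_X, MvPolynomial.eval_X,
      Polynomial.eval_C, Polynomial.eval_X] at *
    rw [hp]

lemma natDegree_linePoly_le {n : ℕ} (q : MvPolynomial (Fin n) ℂ) (w : Fin n → ℂ) :
    (linePoly q w).natDegree ≤ q.totalDegree :=
  (MvPolynomial.aeval_natDegree_le q le_rfl
    (fun j => Polynomial.C (w j) * Polynomial.X) (n := 1)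
    fun _ => (Polynomial.natDegree_C_mul_le _ _).trans Polynomial.natDegree_X_le).trans (mul_one _).le

lemma continuous_eval_linePoly {n : ℕ} (q : MvPolynomial (Fin n) ℂ) :
    Continuous fun x : (Fin n → ℂ) × ℂ => (linePoly q x.1).eval x.2 := by
  simp only [eval_linePoly]
  exact (MvPolynomial.continuous_eval q).comp (by fun_prop)

lemma continuous_eval_derivative_linePoly {n : ℕ} (q : MvPolynomial (Fin n) ℂ) :
    Continuous fun x : (Fin n → ℂ) × ℂ => (linePoly q x.1).derivative.eval x.2 := by
  induction q using MvPolynomial.induction_on with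
  | C a => simpa [linePoly] using continuous_const
  | add p q hp hq =>
    have : ∀ w, linePoly (p + q) w = linePoly p w + linePoly q w := fun w => by simp [linePoly]
    simp only [this, Polynomial.derivative_add, Polynomial.eval_add]
    exact hp.add hq
  | mul_X p j hp =>
    have : ∀ w, linePoly (p * MvPolynomial.X j) w =
        linePoly p w * (Polynomial.C (w j) * Polynomial.X) := fun w => by simp [linePoly]
    simp only [this, Polynomial.derivative_mul, Polynomial.eval_add, Polynomial.eval_mul,
      Polynomial.derivative_C, Polynomial.derivative_X, Polynomial.eval_C, Polynomial.eval_X,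
      Polynomial.eval_zero, Polynomial.eval_one]
    have := continuous_eval_linePoly p
    fun_prop

/-- If `q` has no zero on the closed disk of the complex line through `w x`, for every point `x` of
a set `S`, then `q (w x) / q 0` has a continuous logarithm on `S` whose imaginary part is at most
`deg q · π / 2` in absolute value. -/
lemma exists_continuousOn_log {n : ℕ} (q : MvPolynomial (Fin n) ℂ) (w : ℂ → Fin n → ℂ) (S : Set ℂ)
    (hw : ContinuousOn w S)
    (hq : ∀ z ∈ S, ∀ s : ℂ, ‖s‖ ≤ 1 → MvPolynomial.eval (fun j => w z j * s) q ≠ 0) :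
    ∃ h : ℂ → ℂ, ContinuousOn h S ∧
      (∀ z ∈ S, Complex.exp (h z) * MvPolynomial.eval 0 q = MvPolynomial.eval (w z) q) ∧
      ∀ z ∈ S, |(h z).im| ≤ q.totalDegree * (Real.pi / 2) := by
  have hQ : ∀ z ∈ S, ∀ s : ℂ, ‖s‖ ≤ 1 → (linePoly q (w z)).eval s ≠ 0 := fun z hz s hs => by
    rw [eval_linePoly]; exact hq z hz s hs
  refine ⟨fun z => rootLogSum (linePoly q (w z)), ?_, fun z hz => ?_, fun z hz => ?_⟩
  · rw [continuousOn_iff_continuous_domRestrict]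
    -- The parameter is clamped to `[0, 1]` so that the integrand is continuous for all real `t`.
    let c : ℝ → ℝ := fun t => max 0 (min 1 t)
    have hc : Continuous c := by fun_prop
    have hc01 : ∀ t, c t ∈ Set.Icc (0 : ℝ) 1 := fun t =>
      ⟨le_max_left _ _, max_le zero_le_one (min_le_left _ _)⟩
    have hcid : ∀ t ∈ Set.Icc (0 : ℝ) 1, c t = t := fun t ht => by
      simp [c, min_eq_right ht.2, max_eq_right ht.1]
    have heq : S.domRestrict (fun z => rootLogSum (linePoly q (w z))) = fun z : S =>
        ∫ t in (0 : ℝ)..1, (linePoly q (w z)).derivative.eval ((c t : ℝ) : ℂ) /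
          (linePoly q (w z)).eval ((c t : ℝ) : ℂ) := by
      funext z
      rw [Set.domRestrict_apply, rootLogSum_eq_integral (hQ z z.2)]
      refine intervalIntegral.integral_congr fun t ht => ?_
      rw [Set.uIcc_of_le zero_le_one] at ht
      simp only [hcid t ht]
    rw [heq]
    apply intervalIntegral.continuous_parametric_intervalIntegral_of_continuous'
    have hwS : Continuous fun z : S => w z := continuousOn_iff_continuous_domRestrict.1 hw
    have hm : Continuous fun x : S × ℝ => (w x.1, ((c x.2 : ℝ) : ℂ)) :=
      (hwS.comp continuous_fst).prodMk (Complex.continuous_ofReal.comp (hc.comp continuous_snd))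
    refine Continuous.div ((continuous_eval_derivative_linePoly q).comp hm)
      ((continuous_eval_linePoly q).comp hm) fun x => hQ _ x.1.2 _ ?_
    rw [Complex.norm_real, Real.norm_of_nonneg (hc01 _).1]
    exact (hc01 _).2
  · have := exp_rootLogSum_mul_eval_zero (hQ z hz)
    rw [eval_linePoly, eval_linePoly] at this
    simp only [mul_zero, mul_one] at this
    exact this
  · refine (abs_im_rootLogSum_le (hQ z hz)).trans ?_
    have : 0 ≤ Real.pi / 2 := by positivity
    gcongr
    exact natDegree_linePoly_le q (w z)

/-! ### The leading monomial of a polynomial without zeros outside the closed polydisk -/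

lemma Polynomial.norm_coeff_mul_pow_le {P : Polynomial ℂ} {R M : ℝ} (hR : 0 < R)
    (h : ∀ z : ℂ, ‖z‖ = R → ‖P.eval z‖ ≤ M) (k : ℕ) : ‖P.coeff k‖ * R ^ k ≤ M := by
  have hd : ∀ k : ℕ, iteratedDeriv k (fun z => P.eval z) =
      fun z => ((Polynomial.derivative)^[k] P).eval z := by
    intro k
    induction k with
    | zero => simp
    | succ k ih =>
      rw [iteratedDeriv_succ, ih, Function.iterate_succ_apply']
      funext z
      exact Polynomial.deriv _
  have h1 := Complex.norm_iteratedDeriv_le_of_forall_mem_sphere_norm_le (c := 0) (C := M) k hR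
    (P.differentiable.diffContOnCl) fun z hz => h z (by simpa using hz)
  rw [hd] at h1
  simp only [← Polynomial.coeff_zero_eq_eval_zero, Polynomial.coeff_iterate_derivative, zero_add,
    Nat.descFactorial_self, nsmul_eq_mul, norm_mul, Complex.norm_natCast] at h1
  have hk : (0 : ℝ) < k.factorial := by exact_mod_cast k.factorial_pos
  rw [mul_div_assoc] at h1
  exact (le_div_iff₀ (by positivity)).1 (le_of_mul_le_mul_left h1 hk)

/-- Cauchy's estimates on circles of radius tending to `1` and to infinity. -/
lemma Polynomial.coeff_bounds_of_norm_eval_le {P : Polynomial ℂ} {C : ℝ} {a : ℕ}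
    (h : ∀ z : ℂ, 1 < ‖z‖ → ‖P.eval z‖ ≤ C * ‖z‖ ^ a) (k : ℕ) :
    ‖P.coeff k‖ ≤ C ∧ (a < k → P.coeff k = 0) := by
  have hR : ∀ R : ℝ, 1 < R → ‖P.coeff k‖ * R ^ k ≤ C * R ^ a := fun R hR =>
    P.norm_coeff_mul_pow_le (by linarith)
      (fun z hz => by have := h z (by linarith); rwa [hz] at this) k
  constructor
  · have h1 : Filter.Tendsto (fun R : ℝ => ‖P.coeff k‖ * R ^ k) (nhdsWithin 1 (Set.Ioi 1))
        (nhds (‖P.coeff k‖ * 1 ^ k)) :=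
      (Continuous.tendsto (by fun_prop) _).mono_left nhdsWithin_le_nhds
    have h2 : Filter.Tendsto (fun R : ℝ => C * R ^ a) (nhdsWithin 1 (Set.Ioi 1))
        (nhds (C * 1 ^ a)) :=
      (Continuous.tendsto (by fun_prop) _).mono_left nhdsWithin_le_nhds
    simpa using le_of_tendsto_of_tendsto h1 h2
      (Filter.eventually_of_mem self_mem_nhdsWithin fun R hR' => hR R hR')
  · intro hak
    by_contra hne
    have hpos : 0 < ‖P.coeff k‖ := norm_pos_iff.2 hne
    set R : ℝ := 1 + |C| / ‖P.coeff k‖ + 1 with hRdef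
    have hq : 0 ≤ |C| / ‖P.coeff k‖ := by positivity
    have hR1 : 1 < R := by linarith
    have h1 := hR R hR1
    have h2 : R ^ a * R ≤ R ^ k := by
      rw [← pow_succ]; exact pow_le_pow_right₀ hR1.le hak
    have h3 : 0 < R ^ a := by positivity
    have h4 : ‖P.coeff k‖ * R = 2 * ‖P.coeff k‖ + |C| := by
      rw [hRdef]; field_simp; ring
    have h5 : ‖P.coeff k‖ * (R ^ a * R) ≤ C * R ^ a :=
      (mul_le_mul_of_nonneg_left h2 hpos.le).trans h1
    have h6 : (‖P.coeff k‖ * R) * R ^ a ≤ C * R ^ a := by linarith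
    have h7 := le_of_mul_le_mul_right h6 h3
    linarith [le_abs_self C]

lemma MvPolynomial.eq_zero_of_eval_outside_eq_zero {n : ℕ} {r : MvPolynomial (Fin n) ℂ}
    (h : ∀ z : Fin n → ℂ, (∀ j, 1 < ‖z j‖) → MvPolynomial.eval z r = 0) : r = 0 := by
  refine MvPolynomial.funext_set (fun _ => {z : ℂ | 1 < ‖z‖}) (fun _ => ?_) fun z hz => ?_
  · refine Set.infinite_of_injective_forall_mem (f := fun k : ℕ => ((k + 2 : ℕ) : ℂ)) ?_ fun k => ?_
    · intro a b hab
      have : a + 2 = b + 2 := Nat.cast_injective (R := ℂ) hab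
      omega
    · simp only [Set.mem_ofPred_eq, Complex.norm_natCast]
      push_cast
      have : (0 : ℝ) ≤ k := k.cast_nonneg
      linarith
  · rw [map_zero]
    exact h z fun j => hz j (Set.mem_univ j)

/-- A polynomial dominated by the monomial `z ^ α` outside the closed polydisk has only monomials
dividing `z ^ α`. -/
lemma MvPolynomial.le_of_norm_eval_le : ∀ (n : ℕ) (r : MvPolynomial (Fin n) ℂ) (α : Fin n → ℕ)
    (C : ℝ), (∀ z : Fin n → ℂ, (∀ j, 1 < ‖z j‖) →
      ‖MvPolynomial.eval z r‖ ≤ C * ∏ j, ‖z j‖ ^ α j) →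
    ∀ β ∈ r.support, ∀ j, β j ≤ α j := by
  intro n
  induction n with
  | zero => intro r α C _ β _ j; exact j.elim0
  | succ n ih =>
    intro r α C h β hβ j
    have hb : ∀ s : Fin n → ℂ, (∀ j, 1 < ‖s j‖) → ∀ k : ℕ,
        ‖MvPolynomial.eval s ((MvPolynomial.finSuccEquiv ℂ n r).coeff k)‖ ≤
          C * ∏ j, ‖s j‖ ^ α j.succ ∧
        (α 0 < k → MvPolynomial.eval s ((MvPolynomial.finSuccEquiv ℂ n r).coeff k) = 0) := by
      intro s hs k
      have := Polynomial.coeff_bounds_of_norm_eval_le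
        (P := (MvPolynomial.finSuccEquiv ℂ n r).map (MvPolynomial.eval s))
        (C := C * ∏ j, ‖s j‖ ^ α j.succ) (a := α 0) (fun z hz => by
          rw [← MvPolynomial.eval_eq_eval_mv_eval']
          refine (h (Fin.cons z s) fun j => ?_).trans (le_of_eq ?_)
          · refine Fin.cases ?_ (fun i => ?_) j
            · simpa using hz
            · simpa using hs i
          · rw [Fin.prod_univ_succ]
            simp only [Fin.cons_zero, Fin.cons_succ]
            ring) k
      simpa only [Polynomial.coeff_map] using this
    have hc : MvPolynomial.coeff β.tail ((MvPolynomial.finSuccEquiv ℂ n r).coeff (β 0)) ≠ 0 := by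
      rw [MvPolynomial.finSuccEquiv_coeff_coeff, Finsupp.cons_tail]
      exact MvPolynomial.mem_support_iff.1 hβ
    refine Fin.cases ?_ (fun i => ?_) j
    · by_contra hlt
      refine hc ?_
      rw [MvPolynomial.eq_zero_of_eval_outside_eq_zero fun s hs =>
        (hb s hs (β 0)).2 (not_le.1 hlt), MvPolynomial.coeff_zero]
    · have := ih _ (fun j => α j.succ) C (fun s hs => (hb s hs (β 0)).1) β.tail
        (MvPolynomial.mem_support_iff.2 hc) i
      simpa [Finsupp.tail_apply] using this

/-- The points where a nonzero polynomial does not vanish accumulate at every point. -/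
lemma MvPolynomial.exists_tendsto_eval_ne_zero {n : ℕ} {g : MvPolynomial (Fin n) ℂ} (hg : g ≠ 0)
    (s : Fin n → ℂ) : ∃ c : ℂ → Fin n → ℂ,
      Filter.Tendsto c (nhdsWithin 0 {0}ᶜ) (nhds s) ∧
      ∀ᶠ t in nhdsWithin 0 {0}ᶜ, MvPolynomial.eval (c t) g ≠ 0 := by
  obtain ⟨u, hu⟩ : ∃ u, MvPolynomial.eval u g ≠ 0 := by
    by_contra! h
    exact hg (MvPolynomial.funext fun x => by rw [h x, map_zero])
  let c : ℂ → Fin n → ℂ := fun t j => s j + (u j - s j) * t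
  have hcont : Continuous c := by fun_prop
  refine ⟨c, ?_, ?_⟩
  · have h0 : c 0 = s := by funext j; simp [c]
    have := (hcont.tendsto 0).mono_left (nhdsWithin_le_nhds (s := {0}ᶜ))
    rwa [h0] at this
  · let G : Polynomial ℂ := MvPolynomial.aeval
      (fun j => Polynomial.C (s j) + Polynomial.C (u j - s j) * Polynomial.X) g
    have hG : ∀ t, G.eval t = MvPolynomial.eval (c t) g := by
      intro t
      have : (Polynomial.evalRingHom t).comp (MvPolynomial.aeval
          (fun j => Polynomial.C (s j) + Polynomial.C (u j - s j) * Polynomial.X) :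
            MvPolynomial (Fin n) ℂ →ₐ[ℂ] Polynomial ℂ).toRingHom = MvPolynomial.eval (c t) := by
        apply MvPolynomial.ringHom_ext
        · intro a; simp
        · intro j; simp [c]
      exact congrArg (fun φ : MvPolynomial (Fin n) ℂ →+* ℂ => φ g) this
    have hG0 : G ≠ 0 := by
      intro h
      apply hu
      have h1 : c 1 = u := by funext j; simp [c]
      rw [← h1, ← hG, h, Polynomial.eval_zero]
    have hfin : {t : ℂ | G.IsRoot t}.Finite := Polynomial.finite_setOfPred_isRoot hG0
    have h1 : {t : ℂ | G.IsRoot t}ᶜ ∪ {0} ∈ nhds (0 : ℂ) := by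
      have : ({t : ℂ | G.IsRoot t} \ {0})ᶜ ∈ nhds (0 : ℂ) :=
        (hfin.subset Set.sdiff_subset).isClosed.isOpen_compl.mem_nhds (by simp)
      refine Filter.mem_of_superset this fun t ht => ?_
      by_cases h : t = 0
      · exact Or.inr h
      · exact Or.inl fun hr => ht ⟨hr, h⟩
    filter_upwards [nhdsWithin_le_nhds h1, self_mem_nhdsWithin] with t ht ht0
    rw [← hG]
    exact ht.resolve_right ht0

lemma Polynomial.norm_coeff_le_of_roots {P : Polynomial ℂ} (hP : ∀ z : ℂ, 1 < ‖z‖ → P.eval z ≠ 0)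
    (k : ℕ) : ‖P.coeff k‖ ≤ 2 ^ P.natDegree * ‖P.leadingCoeff‖ := by
  have hP0 : P ≠ 0 := fun h => hP 2 (by simp) (by simp [h])
  have hl : P.leadingCoeff ≠ 0 := Polynomial.leadingCoeff_ne_zero.2 hP0
  have hl' : P.leadingCoeff⁻¹ ≠ 0 := inv_ne_zero hl
  have hdeg : (P * Polynomial.C P.leadingCoeff⁻¹).natDegree = P.natDegree :=
    Polynomial.natDegree_mul_C hl'
  have := Polynomial.coeff_le_of_roots_le (f := RingHom.id ℂ) (B := 1) k
    (Polynomial.monic_mul_leadingCoeff_inv hP0) (IsAlgClosed.splits _) (by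
      intro z hz
      rw [Polynomial.map_id] at hz
      have hr := Polynomial.isRoot_of_mem_roots hz
      rw [Polynomial.IsRoot, Polynomial.eval_mul, Polynomial.eval_C] at hr
      by_contra hlt
      exact (mul_ne_zero (hP z (not_le.1 hlt)) hl') hr)
  rw [Polynomial.map_id, Polynomial.coeff_mul_C, hdeg, one_pow, one_mul, norm_mul, norm_inv] at this
  have hpos : 0 < ‖P.leadingCoeff‖ := norm_pos_iff.2 hl
  rw [← div_eq_mul_inv, div_le_iff₀ hpos] at this
  refine this.trans ?_
  gcongr
  exact_mod_cast Nat.choose_le_two_pow _ _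

/-- A polynomial without zeros outside the closed polydisk has a monomial divisible by all its other
monomials. Expand in the first variable: by Vieta's formulas the leading coefficient dominates the
other coefficients up to a constant, hence it has no zeros outside the closed polydisk either; the
induction hypothesis bounds it by a monomial, which then bounds all the coefficients. -/
lemma MvPolynomial.exists_top_monomial : ∀ (n : ℕ) (p : MvPolynomial (Fin n) ℂ),
    (∀ z : Fin n → ℂ, (∀ j, 1 < ‖z j‖) → MvPolynomial.eval z p ≠ 0) →
    ∃ α ∈ p.support, ∀ β ∈ p.support, β ≤ α := by
  intro n
  induction n with
  | zero =>
    intro p hp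
    refine ⟨0, ?_, fun β _ => by rw [Subsingleton.elim β 0]⟩
    rw [MvPolynomial.mem_support_iff]
    intro h
    apply hp 0 fun j => j.elim0
    rw [MvPolynomial.eval_eq']
    refine Finset.sum_eq_zero fun β _ => ?_
    rw [Subsingleton.elim β 0, h, zero_mul]
  | succ n ih =>
    intro p hp
    set P := MvPolynomial.finSuccEquiv ℂ n p with hPdef
    have hev : ∀ s : Fin n → ℂ, (∀ j, 1 < ‖s j‖) → ∀ z : ℂ, 1 < ‖z‖ →
        (P.map (MvPolynomial.eval s)).eval z ≠ 0 := by
      intro s hs z hz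
      rw [hPdef, ← MvPolynomial.eval_eq_eval_mv_eval']
      refine hp _ fun j => ?_
      refine Fin.cases ?_ (fun i => ?_) j
      · simpa using hz
      · simpa using hs i
    have hP0 : P ≠ 0 := by
      intro h
      exact hev (fun _ => 2) (by simp) 2 (by simp) (by simp [h])
    have hg0 : P.leadingCoeff ≠ 0 := Polynomial.leadingCoeff_ne_zero.2 hP0
    have hdom' : ∀ s : Fin n → ℂ, (∀ j, 1 < ‖s j‖) → MvPolynomial.eval s P.leadingCoeff ≠ 0 →
        ∀ k, ‖MvPolynomial.eval s (P.coeff k)‖ ≤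
          2 ^ P.natDegree * ‖MvPolynomial.eval s P.leadingCoeff‖ := by
      intro s hs hne k
      have := Polynomial.norm_coeff_le_of_roots (hev s hs) k
      rwa [Polynomial.natDegree_map_of_leadingCoeff_ne_zero _ hne,
        Polynomial.leadingCoeff_map_of_leadingCoeff_ne_zero _ hne, Polynomial.coeff_map] at this
    have hdom : ∀ s : Fin n → ℂ, (∀ j, 1 < ‖s j‖) → ∀ k, ‖MvPolynomial.eval s (P.coeff k)‖ ≤
        2 ^ P.natDegree * ‖MvPolynomial.eval s P.leadingCoeff‖ := by
      intro s hs k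
      obtain ⟨c, hc, hne⟩ := MvPolynomial.exists_tendsto_eval_ne_zero hg0 s
      have hout : ∀ᶠ t in nhdsWithin (0 : ℂ) {0}ᶜ, ∀ j, 1 < ‖c t j‖ := by
        rw [Filter.eventually_all]
        intro j
        exact ((tendsto_pi_nhds.1 hc j).norm).eventually (lt_mem_nhds (hs j))
      refine le_of_tendsto_of_tendsto
        ((((MvPolynomial.continuous_eval (P.coeff k)).tendsto s).comp hc).norm)
        (((((MvPolynomial.continuous_eval P.leadingCoeff).tendsto s).comp hc).norm).const_mul
          (2 ^ P.natDegree)) ?_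
      filter_upwards [hne, hout] with t ht ht'
      exact hdom' (c t) ht' ht k
    have hg : ∀ s : Fin n → ℂ, (∀ j, 1 < ‖s j‖) → MvPolynomial.eval s P.leadingCoeff ≠ 0 := by
      intro s hs h0
      refine hev s hs 2 (by simp) ?_
      have : P.map (MvPolynomial.eval s) = 0 := by
        ext k
        have := hdom s hs k
        rw [h0, norm_zero, mul_zero] at this
        rw [Polynomial.coeff_map, Polynomial.coeff_zero]
        exact norm_le_zero_iff.1 this
      rw [this, Polynomial.eval_zero]
    obtain ⟨α, hα, htop⟩ := ih _ hg
    set g := P.leadingCoeff with hgdef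
    have hgb : ∀ s : Fin n → ℂ, (∀ j, 1 < ‖s j‖) → ‖MvPolynomial.eval s g‖ ≤
        (∑ β ∈ g.support, ‖MvPolynomial.coeff β g‖) * ∏ j, ‖s j‖ ^ α j := by
      intro s hs
      rw [MvPolynomial.eval_eq', Finset.sum_mul]
      refine (norm_sum_le _ _).trans (Finset.sum_le_sum fun β hβ => ?_)
      rw [norm_mul, norm_prod]
      simp only [norm_pow]
      gcongr with j _
      · exact (hs j).le
      · exact htop β hβ j
    refine ⟨α.cons P.natDegree, ?_, fun β hβ => ?_⟩
    · rw [MvPolynomial.mem_support_iff, ← MvPolynomial.finSuccEquiv_coeff_coeff]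
      exact MvPolynomial.mem_support_iff.1 hα
    · have hc : MvPolynomial.coeff β.tail (P.coeff (β 0)) ≠ 0 := by
        rw [hPdef, MvPolynomial.finSuccEquiv_coeff_coeff, Finsupp.cons_tail]
        exact MvPolynomial.mem_support_iff.1 hβ
      intro j
      refine Fin.cases ?_ (fun i => ?_) j
      · rw [Finsupp.cons_zero]
        refine Polynomial.le_natDegree_of_ne_zero fun h => hc ?_
        rw [h, MvPolynomial.coeff_zero]
      · have := MvPolynomial.le_of_norm_eval_le n (P.coeff (β 0)) α
          (2 ^ P.natDegree * ∑ β ∈ g.support, ‖MvPolynomial.coeff β g‖) (fun s hs => by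
            rw [mul_assoc]
            exact (hdom s hs (β 0)).trans
              (mul_le_mul_of_nonneg_left (hgb s hs) (by positivity)))
          β.tail (MvPolynomial.mem_support_iff.2 hc) i
        simpa [Finsupp.tail_apply] using this

/-! ### Counting zeros by comparing logarithms in the two half-planes -/

/-- Two continuous logarithms of proportional functions differ by a constant on a preconnected
set. -/
lemma sub_eq_sub_of_exp_mul_eq {S : Set ℂ} (hS : IsPreconnected S) {u v : ℂ → ℂ} {c : ℂ}
    (hu : ContinuousOn u S) (hv : ContinuousOn v S)
    (h : ∀ z ∈ S, Complex.exp (u z) * c = Complex.exp (v z)) {x y : ℂ} (hx : x ∈ S) (hy : y ∈ S) :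
    u x - u y = v x - v y := by
  have hE : ∀ a ∈ S, Complex.exp (v a - u a) = c := fun a ha => by
    rw [Complex.exp_sub, ← h a ha, mul_div_cancel_left₀ _ (Complex.exp_ne_zero _)]
  have := Complex.isCoveringMap_exp.constOn_of_comp hS (hv.sub hu)
    (fun a ha a' ha' => Subtype.ext (by
      show Complex.exp (v a - u a) = Complex.exp (v a' - u a')
      rw [hE a ha, hE a' ha'])) hx hy
  simp only [Pi.sub_apply] at this
  linear_combination -this

lemma exists_eq_pow_mul_of_analyticOrderAt_eq (x : ℂ) : ∀ (m : ℕ) (f : ℂ → ℂ),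
    Differentiable ℂ f → analyticOrderAt f x = m →
    ∃ g : ℂ → ℂ, Differentiable ℂ g ∧ (∀ z, f z = (z - x) ^ m * g z) ∧ g x ≠ 0 := by
  intro m
  induction m with
  | zero =>
    intro f hf h
    refine ⟨f, hf, by simp, ?_⟩
    exact (analyticOrderAt_eq_zero.1 h).resolve_left (not_not.2 (hf.analyticAt x))
  | succ m ih =>
    intro f hf h
    have hfx : f x = 0 := by
      by_contra hne
      rw [analyticOrderAt_eq_zero.2 (Or.inr hne)] at h
      exact absurd h.symm (by simp)
    have hd : Differentiable ℂ (dslope f x) := by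
      rw [← differentiableOn_univ] at hf ⊢
      exact (Complex.differentiableOn_dslope Filter.univ_mem).2 hf
    have heq : ∀ z, f z = (z - x) * dslope f x z := fun z => by
      have := sub_smul_dslope f x z
      rw [hfx, sub_zero, smul_eq_mul] at this
      exact this.symm
    have hord : analyticOrderAt (dslope f x) x = m := by
      have h1 : f = (· - x) * dslope f x := funext heq
      rw [h1, analyticOrderAt_mul (by fun_prop) (hd.analyticAt x),
        analyticOrderAt_id_sub_const_self] at h
      have h2 : (1 : ℕ∞) + analyticOrderAt (dslope f x) x = 1 + m := by
        rw [h]; push_cast; exact add_comm _ _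
      exact (ENat.add_right_injective_of_ne_top ENat.one_ne_top) h2
    obtain ⟨g, hg, hgeq, hgx⟩ := ih _ hd hord
    exact ⟨g, hg, fun z => by rw [heq, hgeq]; ring, hgx⟩

/-- Finitely many zeros of an entire function can be divided out. -/
lemma exists_eq_prod_pow_mul {f : ℂ → ℂ} (hf : Differentiable ℂ f) (m : ℂ → ℕ)
    (hm : ∀ x, analyticOrderAt f x = m x) (Z : Finset ℂ) :
    ∃ g : ℂ → ℂ, Differentiable ℂ g ∧ (∀ z, f z = (∏ x ∈ Z, (z - x) ^ m x) * g z) ∧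
      ∀ x ∈ Z, g x ≠ 0 := by
  classical
  induction Z using Finset.induction_on with
  | empty => exact ⟨f, hf, by simp, by simp⟩
  | insert a Z ha ih =>
    obtain ⟨g, hg, hfg, hgZ⟩ := ih
    have hP : Differentiable ℂ fun z : ℂ => ∏ x ∈ Z, (z - x) ^ m x := by fun_prop
    have hPa : ∏ x ∈ Z, (a - x) ^ m x ≠ 0 := by
      refine Finset.prod_ne_zero_iff.2 fun x hx => pow_ne_zero _ (sub_ne_zero.2 ?_)
      rintro rfl
      exact ha hx
    have hord : analyticOrderAt g a = m a := by
      have h1 : f = (fun z : ℂ => ∏ x ∈ Z, (z - x) ^ m x) * g := funext hfg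
      rw [← hm a, h1, analyticOrderAt_mul (hP.analyticAt a) (hg.analyticAt a),
        (analyticOrderAt_eq_zero (f := fun z : ℂ => ∏ x ∈ Z, (z - x) ^ m x)).2 (Or.inr hPa),
        zero_add]
    obtain ⟨k, hk, hgk, hka⟩ := exists_eq_pow_mul_of_analyticOrderAt_eq a (m a) g hg hord
    refine ⟨k, hk, fun z => ?_, fun x hx => ?_⟩
    · rw [Finset.prod_insert ha, hfg, hgk]; ring
    · rcases Finset.mem_insert.1 hx with rfl | hx
      · exact hka
      · intro h0
        exact hgZ x hx (by rw [hgk, h0, mul_zero])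

/-- The jump of the principal argument across the real axis: `2 π` on the negative half-line and
`0` on the positive one. -/
lemma tendsto_arg_add_mul_I {r : ℝ} (hr : r ≠ 0) :
    Filter.Tendsto (fun η : ℝ => Complex.arg (r + η * Complex.I) - Complex.arg (r - η * Complex.I))
      (nhdsWithin 0 (Set.Ioi 0)) (nhds (if r < 0 then 2 * Real.pi else 0)) := by
  have hp : Filter.Tendsto (fun η : ℝ => (r : ℂ) + η * Complex.I) (nhdsWithin 0 (Set.Ioi 0))
      (nhds r) := by
    have : Continuous fun η : ℝ => (r : ℂ) + η * Complex.I := by fun_prop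
    simpa using (this.tendsto 0).mono_left nhdsWithin_le_nhds
  have hm : Filter.Tendsto (fun η : ℝ => (r : ℂ) - η * Complex.I) (nhdsWithin 0 (Set.Ioi 0))
      (nhds r) := by
    have : Continuous fun η : ℝ => (r : ℂ) - η * Complex.I := by fun_prop
    simpa using (this.tendsto 0).mono_left nhdsWithin_le_nhds
  split_ifs with h
  · have hp' := tendsto_nhdsWithin_iff.2 ⟨hp, (Filter.eventually_of_mem self_mem_nhdsWithin
      fun η (hη : 0 < η) => by simpa using hη.le :
        ∀ᶠ η : ℝ in nhdsWithin 0 (Set.Ioi 0), (r : ℂ) + η * Complex.I ∈ {z : ℂ | 0 ≤ z.im})⟩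
    have hm' := tendsto_nhdsWithin_iff.2 ⟨hm, (Filter.eventually_of_mem self_mem_nhdsWithin
      fun η (hη : 0 < η) => by simpa using hη :
        ∀ᶠ η : ℝ in nhdsWithin 0 (Set.Ioi 0), (r : ℂ) - η * Complex.I ∈ {z : ℂ | z.im < 0})⟩
    have h1 := (Complex.tendsto_arg_nhdsWithin_im_nonneg_of_re_neg_of_im_zero
      (z := (r : ℂ)) (by simpa using h) (by simp)).comp hp'
    have h2 := (Complex.tendsto_arg_nhdsWithin_im_neg_of_re_neg_of_im_zero
      (z := (r : ℂ)) (by simpa using h) (by simp)).comp hm'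
    have h3 := h1.sub h2
    rwa [sub_neg_eq_add, ← two_mul] at h3
  · have hc : ContinuousAt Complex.arg (r : ℂ) := Complex.continuousAt_arg
      (Or.inl (by simpa using lt_of_le_of_ne (not_lt.1 h) hr.symm))
    simpa using (hc.tendsto.comp hp).sub (hc.tendsto.comp hm)

/-- Suppose that near `[a, b]` the function `f` is a product of linear factors, with zeros in
`(a, b)`, and an exponential. On each half-plane its argument can be followed along the interval in
two ways, by the given logarithm or factor by factor. The factors contribute `-π` each above and `π`
each below the real axis, so the difference of the two comparisons counts the zeros. -/
lemma abs_two_pi_mul_card_sub_le_of_factorization {f G hp hm : ℂ → ℂ} {p₀ c : ℂ} {L K : ℝ}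
    (hpc : ContinuousOn hp {z | 0 < z.im})
    (hpe : ∀ z : ℂ, 0 < z.im → Complex.exp (hp z) * p₀ = f z)
    (hpK : ∀ z : ℂ, 0 < z.im → |(hp z).im| ≤ K)
    (hmc : ContinuousOn hm {z | z.im < 0})
    (hme : ∀ z : ℂ, z.im < 0 → Complex.exp (Complex.I * L * z + hm z) * c = f z)
    (hmK : ∀ z : ℂ, z.im < 0 → |(hm z).im| ≤ K)
    {V : Set ℂ} (hVc : Convex ℝ V) (hVo : IsOpen V) (hG : ContinuousOn G V)
    (Z : Finset ℝ) (m : ℝ → ℕ)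
    (hf : ∀ z ∈ V, f z = (∏ x ∈ Z, (z - x) ^ m x) * Complex.exp (G z))
    {a b : ℝ} (haV : (a : ℂ) ∈ V) (hbV : (b : ℂ) ∈ V) (hZ : ∀ x ∈ Z, a < x ∧ x < b) :
    |2 * Real.pi * (∑ x ∈ Z, (m x : ℝ)) - L * (b - a)| ≤ 4 * K := by
  let v : ℂ → ℂ := fun z => G z + ∑ x ∈ Z, (m x : ℂ) * Complex.log (z - x)
  have hne : ∀ z : ℂ, z.im ≠ 0 → ∀ x : ℝ, z - x ∈ Complex.slitPlane := fun z hz x =>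
    Or.inr (by simpa using hz)
  have hve : ∀ z ∈ V, z.im ≠ 0 → Complex.exp (v z) = f z := by
    intro z hz hzi
    rw [hf z hz, Complex.exp_add, Complex.exp_sum, mul_comm]
    congr 1
    refine Finset.prod_congr rfl fun x _ => ?_
    rw [Complex.exp_nat_mul, Complex.exp_log (Complex.slitPlane_ne_zero (hne z hzi x))]
  have hvc : ContinuousOn v (V ∩ {z | z.im ≠ 0}) := by
    refine (hG.mono Set.inter_subset_left).add (continuousOn_finsetSum _ fun x _ => ?_)
    refine continuousOn_const.mul (ContinuousOn.clog (by fun_prop) fun z hz => hne z hz.2 x)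
  have hup : ∀ x ∈ V, ∀ y ∈ V, 0 < x.im → 0 < y.im → hp x - hp y = v x - v y := by
    intro x hx y hy hx' hy'
    have hconv : Convex ℝ (V ∩ {z | 0 < z.im}) := hVc.inter (convex_halfSpace_im_gt 0)
    exact sub_eq_sub_of_exp_mul_eq hconv.isPreconnected (hpc.mono Set.inter_subset_right)
      (hvc.mono fun z hz => ⟨hz.1, ne_of_gt hz.2⟩)
      (fun z hz => by rw [hpe z hz.2, hve z hz.1 (ne_of_gt hz.2)]) ⟨hx, hx'⟩ ⟨hy, hy'⟩
  have hlow : ∀ x ∈ V, ∀ y ∈ V, x.im < 0 → y.im < 0 →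
      (Complex.I * L * x + hm x) - (Complex.I * L * y + hm y) = v x - v y := by
    intro x hx y hy hx' hy'
    have hconv : Convex ℝ (V ∩ {z | z.im < 0}) := hVc.inter (convex_halfSpace_im_lt 0)
    exact sub_eq_sub_of_exp_mul_eq (u := fun z => Complex.I * L * z + hm z) (c := c)
      hconv.isPreconnected
      (ContinuousOn.add (by fun_prop) (hmc.mono Set.inter_subset_right))
      (hvc.mono fun z hz => ⟨hz.1, ne_of_lt hz.2⟩)
      (fun z hz => by rw [hme z hz.2, hve z hz.1 (ne_of_lt hz.2)]) ⟨hx, hx'⟩ ⟨hy, hy'⟩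
  -- The jump of the argument of `f` across the real axis.
  let J : ℝ → ℝ → ℝ := fun t η => (v (t + η * Complex.I)).im - (v (t - η * Complex.I)).im
  have hJ : ∀ t : ℝ, (t : ℂ) ∈ V → (∀ x ∈ Z, t ≠ x) → Filter.Tendsto (J t)
      (nhdsWithin 0 (Set.Ioi 0))
      (nhds (∑ x ∈ Z, (m x : ℝ) * if t - x < 0 then 2 * Real.pi else 0)) := by
    intro t ht htZ
    have hGt : ContinuousAt G t := hG.continuousAt (hVo.mem_nhds ht)
    have h1 : Filter.Tendsto (fun η : ℝ => (t : ℂ) + η * Complex.I) (nhdsWithin 0 (Set.Ioi 0))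
        (nhds t) := by
      have : Continuous fun η : ℝ => (t : ℂ) + η * Complex.I := by fun_prop
      simpa using (this.tendsto 0).mono_left nhdsWithin_le_nhds
    have h2 : Filter.Tendsto (fun η : ℝ => (t : ℂ) - η * Complex.I) (nhdsWithin 0 (Set.Ioi 0))
        (nhds t) := by
      have : Continuous fun η : ℝ => (t : ℂ) - η * Complex.I := by fun_prop
      simpa using (this.tendsto 0).mono_left nhdsWithin_le_nhds
    have h3 : Filter.Tendsto (fun η : ℝ => (G (t + η * Complex.I)).im - (G (t - η * Complex.I)).im)
        (nhdsWithin 0 (Set.Ioi 0)) (nhds 0) := by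
      have := ((Complex.continuous_im.tendsto _).comp (hGt.tendsto.comp h1)).sub
        ((Complex.continuous_im.tendsto _).comp (hGt.tendsto.comp h2))
      simpa using this
    have h4 := h3.add (tendsto_finsetSum Z fun x hx =>
      (tendsto_arg_add_mul_I (sub_ne_zero.2 (htZ x hx))).const_mul (m x : ℝ))
    rw [zero_add] at h4
    refine h4.congr fun η => ?_
    have e1 : ∀ x : ℝ, (t : ℂ) + η * Complex.I - x = ((t - x : ℝ) : ℂ) + η * Complex.I :=
      fun x => by push_cast; ring
    have e2 : ∀ x : ℝ, (t : ℂ) - η * Complex.I - x = ((t - x : ℝ) : ℂ) - η * Complex.I :=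
      fun x => by push_cast; ring
    have e3 : ∀ w : ℂ, (∑ x ∈ Z, (m x : ℂ) * Complex.log (w - x)).im =
        ∑ x ∈ Z, (m x : ℝ) * Complex.arg (w - x) := fun w => by
      rw [Complex.im_sum]
      refine Finset.sum_congr rfl fun x _ => ?_
      rw [← Complex.ofReal_natCast, Complex.im_ofReal_mul, Complex.log_im]
    simp only [J, v, Complex.add_im, e3, e1, e2, mul_sub, Finset.sum_sub_distrib]
    ring
  have hlim := ((hJ a haV fun x hx => (hZ x hx).1.ne).sub
    (hJ b hbV fun x hx => (hZ x hx).2.ne')).sub_const (L * (b - a))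
  have hval : (∑ x ∈ Z, (m x : ℝ) * if a - x < 0 then 2 * Real.pi else 0) -
      (∑ x ∈ Z, (m x : ℝ) * if b - x < 0 then 2 * Real.pi else 0) =
        2 * Real.pi * ∑ x ∈ Z, (m x : ℝ) := by
    rw [← Finset.sum_sub_distrib, Finset.mul_sum]
    refine Finset.sum_congr rfl fun x hx => ?_
    rw [if_pos (by linarith [(hZ x hx).1]), if_neg (by linarith [(hZ x hx).2])]
    ring
  rw [hval] at hlim
  refine le_of_tendsto hlim.abs ?_
  have hev : ∀ t : ℝ, (t : ℂ) ∈ V → ∀ᶠ η : ℝ in nhdsWithin 0 (Set.Ioi 0),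
      (t : ℂ) + η * Complex.I ∈ V ∧ (t : ℂ) - η * Complex.I ∈ V := by
    intro t ht
    have h1 : Continuous fun η : ℝ => (t : ℂ) + η * Complex.I := by fun_prop
    have h2 : Continuous fun η : ℝ => (t : ℂ) - η * Complex.I := by fun_prop
    exact nhdsWithin_le_nhds (((h1.tendsto 0).eventually (hVo.mem_nhds (by simpa using ht))).and
      ((h2.tendsto 0).eventually (hVo.mem_nhds (by simpa using ht))))
  filter_upwards [hev a haV, hev b hbV, self_mem_nhdsWithin] with η ha hb hη
  have hη : 0 < η := hη
  have ip : ∀ t : ℝ, 0 < ((t : ℂ) + η * Complex.I).im := fun t => by simpa using hη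
  have im : ∀ t : ℝ, ((t : ℂ) - η * Complex.I).im < 0 := fun t => by simpa using hη
  have h1 := congrArg Complex.im (hup _ ha.1 _ hb.1 (ip a) (ip b))
  have h2 := congrArg Complex.im (hlow _ ha.2 _ hb.2 (im a) (im b))
  simp only [Complex.sub_im, Complex.add_im, Complex.mul_im, Complex.mul_re, Complex.I_re,
    Complex.I_im, Complex.ofReal_re, Complex.ofReal_im, Complex.sub_re] at h1 h2
  have k1 := abs_le.1 (hpK _ (ip a))
  have k2 := abs_le.1 (hpK _ (ip b))
  have k3 := abs_le.1 (hmK _ (im a))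
  have k4 := abs_le.1 (hmK _ (im b))
  simp only [J]
  rw [abs_le]
  constructor <;> nlinarith

/-- An entire function with bounded continuous logarithms, up to the factor `exp (i L z)`, on both
open half-planes has `L (b - a) / 2π` zeros in `[a, b]`, up to a bounded error. -/
lemma exists_finset_zeros_abs_count_sub_le {f hp hm : ℂ → ℂ} {p₀ c : ℂ} {L K : ℝ}
    (hf : Differentiable ℂ f) (hp₀ : p₀ ≠ 0) (hc₀ : c ≠ 0)
    (hpc : ContinuousOn hp {z | 0 < z.im})
    (hpe : ∀ z : ℂ, 0 < z.im → Complex.exp (hp z) * p₀ = f z)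
    (hpK : ∀ z : ℂ, 0 < z.im → |(hp z).im| ≤ K)
    (hmc : ContinuousOn hm {z | z.im < 0})
    (hme : ∀ z : ℂ, z.im < 0 → Complex.exp (Complex.I * L * z + hm z) * c = f z)
    (hmK : ∀ z : ℂ, z.im < 0 → |(hm z).im| ≤ K)
    (m : ℂ → ℕ) (hmult : ∀ x, analyticOrderAt f x = m x) {a b : ℝ} (hab : a < b) :
    ∃ Z : Finset ℝ, (∀ x, x ∈ Z ↔ x ∈ Set.Icc a b ∧ f (x : ℂ) = 0) ∧
      |2 * Real.pi * (∑ x ∈ Z, (m (x : ℂ) : ℝ)) - L * (b - a)| ≤ 4 * K := by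
  classical
  have hreal : ∀ z : ℂ, f z = 0 → z.im = 0 := by
    intro z hz
    rcases lt_trichotomy z.im 0 with h | h | h
    · rw [← hme z h] at hz
      exact absurd hz (mul_ne_zero (Complex.exp_ne_zero _) hc₀)
    · exact h
    · rw [← hpe z h] at hz
      exact absurd hz (mul_ne_zero (Complex.exp_ne_zero _) hp₀)
  have hfin : ∀ u v : ℝ, {x : ℝ | x ∈ Set.Icc u v ∧ f (x : ℂ) = 0}.Finite := by
    intro u v
    have hcod := AnalyticOnNhd.preimage_zero_mem_codiscrete (f := f) (x := Complex.I)
      (fun z _ => hf.analyticAt z) (fun h => by simpa using hreal _ h)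
    have hK : IsCompact (Complex.ofReal '' Set.Icc u v) :=
      isCompact_Icc.image Complex.continuous_ofReal
    have h1 := hK.finite_sdiff_of_mem_codiscreteWithin
      (Filter.codiscreteWithin_mono (Set.subset_univ _) hcod)
    refine Set.Finite.of_finite_image (f := Complex.ofReal) (h1.subset ?_)
      Complex.ofReal_injective.injOn
    rintro _ ⟨x, ⟨hx, hx0⟩, rfl⟩
    exact ⟨⟨x, hx, rfl⟩, fun h => h hx0⟩
  let Z := (hfin a b).toFinset
  have hZ : ∀ x, x ∈ Z ↔ x ∈ Set.Icc a b ∧ f (x : ℂ) = 0 := fun x => by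
    simp only [Z, Set.Finite.mem_toFinset, Set.mem_ofPred_eq]
  refine ⟨Z, hZ, ?_⟩
  obtain ⟨g, hg, hfg, hgZ⟩ :=
    exists_eq_prod_pow_mul hf m hmult (Z.map ⟨Complex.ofReal, Complex.ofReal_injective⟩)
  simp only [Finset.prod_map, Function.Embedding.coeFn_mk, Finset.mem_map, forall_exists_index,
    and_imp, forall_apply_eq_imp_iff₂] at hfg hgZ
  -- All zeros of `f` in a slightly larger interval already lie in `[a, b]`.
  have hsep : ∀ᶠ ε : ℝ in nhdsWithin 0 (Set.Ioi 0), ∀ x : ℝ, f (x : ℂ) = 0 →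
      a - 2 * ε < x → x < b + 2 * ε → x ∈ Set.Icc a b := by
    have hF := hfin (a - 1) (b + 1)
    have h1 : ∀ x ∈ {x : ℝ | x ∈ Set.Icc (a - 1) (b + 1) ∧ f (x : ℂ) = 0},
        ∀ᶠ ε : ℝ in nhdsWithin 0 (Set.Ioi 0),
          a - 2 * ε < x → x < b + 2 * ε → x ∈ Set.Icc a b := by
      intro x _
      have ta : ContinuousAt (fun ε : ℝ => a - 2 * ε) 0 := by fun_prop
      have tb : ContinuousAt (fun ε : ℝ => b + 2 * ε) 0 := by fun_prop
      rcases lt_or_ge x a with h | h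
      · have := ta.eventually (lt_mem_nhds (show x < a - 2 * 0 by simpa using h))
        filter_upwards [nhdsWithin_le_nhds this] with ε hε h1
        exact absurd h1 (not_lt.2 hε.le)
      rcases lt_or_ge b x with h' | h'
      · have := tb.eventually (gt_mem_nhds (show b + 2 * 0 < x by simpa using h'))
        filter_upwards [nhdsWithin_le_nhds this] with ε hε _ h2
        exact absurd h2 (not_lt.2 hε.le)
      · exact Filter.Eventually.of_forall fun _ _ _ => ⟨h, h'⟩
    have h2 := (Filter.eventually_all_finite hF).2 h1
    have h3 : ∀ᶠ ε : ℝ in nhdsWithin 0 (Set.Ioi 0), ε < 1 / 2 :=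
      nhdsWithin_le_nhds (gt_mem_nhds (by norm_num))
    filter_upwards [h2, h3] with ε hε hε1 x hx hxa hxb
    exact hε x ⟨⟨by linarith, by linarith⟩, hx⟩ hxa hxb
  have hlim : Filter.Tendsto (fun ε : ℝ => |2 * Real.pi * (∑ x ∈ Z, (m (x : ℂ) : ℝ)) -
      L * ((b + ε) - (a - ε))|) (nhdsWithin 0 (Set.Ioi 0))
      (nhds |2 * Real.pi * (∑ x ∈ Z, (m (x : ℂ) : ℝ)) - L * (b - a)|) := by
    have : Continuous fun ε : ℝ => |2 * Real.pi * (∑ x ∈ Z, (m (x : ℂ) : ℝ)) -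
      L * ((b + ε) - (a - ε))| := by fun_prop
    simpa using (this.tendsto 0).mono_left nhdsWithin_le_nhds
  refine le_of_tendsto hlim ?_
  filter_upwards [hsep, self_mem_nhdsWithin] with ε hε hε0
  have hε0 : 0 < ε := hε0
  let V : Set ℂ := {z | a - 2 * ε < z.re} ∩ {z | z.re < b + 2 * ε}
  have hVc : Convex ℝ V := (convex_halfSpace_re_gt _).inter (convex_halfSpace_re_lt _)
  have hVo : IsOpen V := (isOpen_lt continuous_const Complex.continuous_re).inter
    (isOpen_lt Complex.continuous_re continuous_const)
  have haV : ((a - ε : ℝ) : ℂ) ∈ V := by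
    constructor <;> simp only [Set.mem_ofPred_eq, Complex.ofReal_re] <;> linarith
  have hbV : ((b + ε : ℝ) : ℂ) ∈ V := by
    constructor <;> simp only [Set.mem_ofPred_eq, Complex.ofReal_re] <;> linarith
  have hgV : ∀ z ∈ V, g z ≠ 0 := by
    intro z hz h0
    have hfz : f z = 0 := by rw [hfg, h0, mul_zero]
    have hzr : ((z.re : ℝ) : ℂ) = z := Complex.ext (by simp) (by simp [hreal z hfz])
    have hzI := hε z.re (by rw [hzr]; exact hfz) hz.1 hz.2
    exact hgZ z.re ((hZ _).2 ⟨hzI, by rw [hzr]; exact hfz⟩) (by rw [hzr]; exact h0)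
  have hVs : IsSimplyConnected V := by
    have := hVc.contractibleSpace ⟨_, haV⟩
    exact SimplyConnectedSpace.ofContractible V
  obtain ⟨G, hGc, hGe⟩ := Complex.exists_continuousOn_eqOn_exp_comp hVs hVo
    hg.continuous.continuousOn (by rintro ⟨z, hz, h0⟩; exact hgV z hz h0)
  exact abs_two_pi_mul_card_sub_le_of_factorization hpc hpe hpK hmc hme hmK hVc hVo hGc Z
    (fun x => m (x : ℂ)) (fun z hz => by rw [hfg z, ← hGe hz]; rfl) haV hbV fun x hx => by
      have := ((hZ x).1 hx).1
      exact ⟨by linarith [this.1], by linarith [this.2]⟩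

/-! ### The reversed polynomial -/

/-- The reversed polynomial `z ^ d * p (1 / z)`, for a polynomial `p` whose monomials all divide
`z ^ d`. -/
noncomputable def reversePoly {n : ℕ} (p : MvPolynomial (Fin n) ℂ) (d : Fin n →₀ ℕ) :
    MvPolynomial (Fin n) ℂ :=
  ∑ β ∈ p.support, MvPolynomial.monomial (d - β) (MvPolynomial.coeff β p)

lemma eval_reversePoly {n : ℕ} {p : MvPolynomial (Fin n) ℂ} {d : Fin n →₀ ℕ}
    (hd : ∀ β ∈ p.support, β ≤ d) {w : Fin n → ℂ} (hw : ∀ j, w j ≠ 0) :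
    MvPolynomial.eval w (reversePoly p d) =
      (∏ j, w j ^ d j) * MvPolynomial.eval (fun j => (w j)⁻¹) p := by
  rw [reversePoly, map_sum, MvPolynomial.eval_eq', Finset.mul_sum]
  refine Finset.sum_congr rfl fun β hβ => ?_
  rw [MvPolynomial.eval_monomial, Finsupp.prod_fintype _ _ fun j => pow_zero _, mul_left_comm,
    ← Finset.prod_mul_distrib]
  congr 1
  refine Finset.prod_congr rfl fun j _ => ?_
  rw [Finsupp.tsub_apply, pow_sub₀ _ (hw j) (hd β hβ j), inv_pow]

lemma eval_zero_reversePoly {n : ℕ} {p : MvPolynomial (Fin n) ℂ} {d : Fin n →₀ ℕ}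
    (hd : ∀ β ∈ p.support, β ≤ d) :
    MvPolynomial.eval 0 (reversePoly p d) = MvPolynomial.coeff d p := by
  rw [reversePoly, map_sum, Finset.sum_eq_single d]
  · simp
  · intro β hβ hne
    obtain ⟨j, hj⟩ : ∃ j, β j ≠ d j := by
      by_contra! h
      exact hne (Finsupp.ext h)
    rw [MvPolynomial.eval_monomial, Finsupp.prod_fintype _ _ fun j => pow_zero _]
    refine mul_eq_zero_of_right _ (Finset.prod_eq_zero (Finset.mem_univ j) ?_)
    have := hd β hβ j
    exact zero_pow (by rw [Finsupp.tsub_apply]; omega)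
  · intro h
    simp [MvPolynomial.notMem_support_iff.1 h]

lemma totalDegree_reversePoly_le {n : ℕ} (p : MvPolynomial (Fin n) ℂ) (d : Fin n →₀ ℕ) :
    (reversePoly p d).totalDegree ≤ ∑ j, d j := by
  refine MvPolynomial.totalDegree_finsetSum_le fun β _ => ?_
  refine (MvPolynomial.totalDegree_monomial_le _ _).trans ?_
  rw [Finsupp.sum_fintype _ _ fun _ => rfl]
  exact Finset.sum_le_sum fun j _ => by simp

/-! ### Zeros of Lee-Yang exponential polynomials -/

lemma le_of_mem_support_of_mem_LY {n : ℕ} {d : Fin n → ℕ} {p : MvPolynomial (Fin n) ℂ}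
    (hp : p ∈ LY n d) {β : Fin n →₀ ℕ} (hβ : β ∈ p.support) (j : Fin n) : β j ≤ d j := by
  rw [← hp.2 j]
  exact MvPolynomial.monomial_le_degreeOf j hβ

lemma coeff_ne_zero_of_mem_LY {n : ℕ} {d : Fin n → ℕ} {p : MvPolynomial (Fin n) ℂ}
    (hp : p ∈ LY n d) : MvPolynomial.coeff (Finsupp.equivFunOnFinite.symm d) p ≠ 0 := by
  obtain ⟨α, hα, htop⟩ := MvPolynomial.exists_top_monomial n p hp.1.2
  have : Finsupp.equivFunOnFinite.symm d = α := by
    ext j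
    refine le_antisymm ?_ (le_of_mem_support_of_mem_LY hp hα j)
    show d j ≤ α j
    rw [← hp.2 j, MvPolynomial.degreeOf_le_iff]
    exact fun β hβ => htop β hβ j
  rw [this]
  exact MvPolynomial.mem_support_iff.1 hα

lemma differentiable_expPoly {n : ℕ} (p : MvPolynomial (Fin n) ℂ) (l : Fin n → ℝ) :
    Differentiable ℂ (expPoly p l) := by
  have : expPoly p l = fun z => ∑ β ∈ p.support, MvPolynomial.coeff β p *
      ∏ j, Complex.exp (Complex.I * z * (l j : ℂ)) ^ β j := by
    funext z
    rw [expPoly, MvPolynomial.eval_eq']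
  rw [this]
  fun_prop

/-- In the upper half-plane all `exp (i z ℓ_j)` lie in the open unit disk. -/
lemma exists_log_expPoly_upper {n : ℕ} {d : Fin n → ℕ} {p : MvPolynomial (Fin n) ℂ}
    (hp : p ∈ LY n d) {l : Fin n → ℝ} (hl : ∀ j, 0 < l j) :
    ∃ h : ℂ → ℂ, ContinuousOn h {z | 0 < z.im} ∧
      (∀ z : ℂ, 0 < z.im → Complex.exp (h z) * MvPolynomial.eval 0 p = expPoly p l z) ∧
      ∀ z : ℂ, 0 < z.im → |(h z).im| ≤ (∑ j, (d j : ℝ)) * (Real.pi / 2) := by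
  obtain ⟨h, hc, he, hK⟩ := exists_continuousOn_log p
    (fun z j => Complex.exp (Complex.I * z * (l j : ℂ))) {z | 0 < z.im} (by fun_prop) (by
      intro z hz s hs
      refine hp.1.1 _ fun j => ?_
      rw [norm_mul, Complex.norm_exp]
      have h1 : (Complex.I * z * (l j : ℂ)).re < 0 := by
        simpa using mul_pos (show 0 < z.im from hz) (hl j)
      calc _ ≤ Real.exp _ * 1 := by gcongr
        _ < 1 := by rw [mul_one]; exact Real.exp_lt_one_iff.2 h1)
  refine ⟨h, hc, he, fun z hz => (hK z hz).trans ?_⟩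
  have : (p.totalDegree : ℝ) ≤ ∑ j, (d j : ℝ) := by
    exact_mod_cast Finset.sup_le fun β hβ => by
      rw [Finsupp.sum_fintype _ _ fun _ => rfl]
      exact Finset.sum_le_sum fun j _ => le_of_mem_support_of_mem_LY hp hβ j
  have := Real.pi_pos
  gcongr

/-- In the lower half-plane all `exp (-i z ℓ_j)` lie in the open unit disk, and the reversed
polynomial takes the value `exp (-i ⟨d, ℓ⟩ z) f z` there. -/
lemma exists_log_expPoly_lower {n : ℕ} {d : Fin n → ℕ} {p : MvPolynomial (Fin n) ℂ}
    (hp : p ∈ LY n d) {l : Fin n → ℝ} (hl : ∀ j, 0 < l j) :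
    ∃ h : ℂ → ℂ, ContinuousOn h {z | z.im < 0} ∧
      (∀ z : ℂ, z.im < 0 → Complex.exp (Complex.I * ((∑ j, (d j : ℝ) * l j : ℝ) : ℂ) * z + h z) *
        MvPolynomial.coeff (Finsupp.equivFunOnFinite.symm d) p = expPoly p l z) ∧
      ∀ z : ℂ, z.im < 0 → |(h z).im| ≤ (∑ j, (d j : ℝ)) * (Real.pi / 2) := by
  set δ : Fin n →₀ ℕ := Finsupp.equivFunOnFinite.symm d with hδ
  have hδd : ∀ j, δ j = d j := fun j => rfl
  have hle : ∀ β ∈ p.support, β ≤ δ := fun β hβ j => le_of_mem_support_of_mem_LY hp hβ j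
  obtain ⟨h, hc, he, hK⟩ := exists_continuousOn_log (reversePoly p δ)
    (fun z j => Complex.exp (-(Complex.I * z * (l j : ℂ)))) {z | z.im < 0} (by fun_prop) (by
      intro z hz s hs
      rcases eq_or_ne s 0 with rfl | hs0
      · simp only [mul_zero]
        exact (eval_zero_reversePoly hle).trans_ne (coeff_ne_zero_of_mem_LY hp)
      have hw : ∀ j, Complex.exp (-(Complex.I * z * (l j : ℂ))) * s ≠ 0 := fun j =>
        mul_ne_zero (Complex.exp_ne_zero _) hs0
      rw [eval_reversePoly hle hw]
      refine mul_ne_zero (Finset.prod_ne_zero_iff.2 fun j _ => pow_ne_zero _ (hw j)) ?_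
      refine hp.1.2 _ fun j => ?_
      rw [norm_inv]
      refine (one_lt_inv₀ (norm_pos_iff.2 (hw j))).2 ?_
      rw [norm_mul, Complex.norm_exp]
      have h1 : (-(Complex.I * z * (l j : ℂ))).re < 0 := by
        simpa using mul_neg_of_neg_of_pos (show z.im < 0 from hz) (hl j)
      calc _ ≤ Real.exp _ * 1 := by gcongr
        _ < 1 := by rw [mul_one]; exact Real.exp_lt_one_iff.2 h1)
  refine ⟨h, hc, fun z hz => ?_, fun z hz => (hK z hz).trans ?_⟩
  · have h1 := he z hz
    rw [eval_zero_reversePoly hle, eval_reversePoly hle fun j => Complex.exp_ne_zero _] at h1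
    rw [Complex.exp_add, mul_assoc, h1, ← mul_assoc]
    have h2 : Complex.exp (Complex.I * ((∑ j, (d j : ℝ) * l j : ℝ) : ℂ) * z) *
        ∏ j, Complex.exp (-(Complex.I * z * (l j : ℂ))) ^ δ j = 1 := by
      simp only [← Complex.exp_nat_mul, ← Complex.exp_sum, ← Complex.exp_add, hδd]
      rw [Complex.exp_eq_one_iff]
      refine ⟨0, ?_⟩
      push_cast
      rw [Finset.mul_sum, Finset.sum_mul, ← Finset.sum_add_distrib, zero_mul]
      exact Finset.sum_eq_zero fun j _ => by ring
    rw [h2, one_mul, expPoly]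
    simp only [Complex.exp_neg, inv_inv]
  · have : ((reversePoly p δ).totalDegree : ℝ) ≤ ∑ j, (d j : ℝ) := by
      exact_mod_cast totalDegree_reversePoly_le p δ
    have := Real.pi_pos
    gcongr

lemma analyticOrderAt_expPoly_ne_top {n : ℕ} {d : Fin n → ℕ} {p : MvPolynomial (Fin n) ℂ}
    (hp : p ∈ LY n d) {l : Fin n → ℝ} (hl : ∀ j, 0 < l j) (z : ℂ) :
    analyticOrderAt (expPoly p l) z ≠ ⊤ := by
  rw [Ne, AnalyticOnNhd.analyticOrderAt_eq_top_iff_eq_zero z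
    fun z => (differentiable_expPoly p l).analyticAt z]
  intro h
  obtain ⟨g, -, hg, -⟩ := exists_log_expPoly_upper hp hl
  have h1 := hg Complex.I (by simp)
  rw [h] at h1
  exact mul_ne_zero (Complex.exp_ne_zero _) (hp.1.1 0 (by simp)) h1

/-- The zeros in a compact interval, counted with multiplicity, have density `⟨d, ℓ⟩ / 2π` up to an
error of at most `|d|`. -/
lemma exists_finset_zeroSet_abs_count_sub_le {n : ℕ} {d : Fin n → ℕ}
    {p : MvPolynomial (Fin n) ℂ} (hp : p ∈ LY n d) {l : Fin n → ℝ} (hl : ∀ j, 0 < l j) {a b : ℝ}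
    (hab : a < b) :
    ∃ Z : Finset ℝ, (∀ x, x ∈ Z ↔ x ∈ Set.Icc a b ∧ x ∈ zeroSet p l) ∧
      |2 * Real.pi * (∑ x ∈ Z, ((zeroMult p l x).toNat : ℝ)) - (∑ j, (d j : ℝ) * l j) * (b - a)| ≤
        2 * Real.pi * ∑ j, (d j : ℝ) := by
  obtain ⟨hu, huc, hue, huK⟩ := exists_log_expPoly_upper hp hl
  obtain ⟨hm, hmc, hme, hmK⟩ := exists_log_expPoly_lower hp hl
  obtain ⟨Z, hZ, hcount⟩ := exists_finset_zeros_abs_count_sub_le (differentiable_expPoly p l)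
    (hp.1.1 0 (by simp)) (coeff_ne_zero_of_mem_LY hp) huc hue huK hmc hme hmK
    (fun z => (analyticOrderAt (expPoly p l) z).toNat)
    (fun z => (ENat.natCast_toNat (analyticOrderAt_expPoly_ne_top hp hl z)).symm) hab
  exact ⟨Z, hZ, hcount.trans (le_of_eq (by ring))⟩

/-! ### The zero measure -/

lemma zeroMeasure_eq_sum {n : ℕ} {p : MvPolynomial (Fin n) ℂ} {l : Fin n → ℝ} {s : Set ℝ}
    (hs : MeasurableSet s) {Z : Finset ℝ} (hZ : ∀ x, x ∈ Z ↔ x ∈ s ∧ x ∈ zeroSet p l) :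
    zeroMeasure p l s = ∑ x ∈ Z, (zeroMult p l x : ℝ≥0∞) := by
  classical
  rw [zeroMeasure, Measure.sum_apply _ hs]
  simp only [Measure.smul_apply, smul_eq_mul, Measure.dirac_apply' _ hs]
  rw [tsum_subtype (zeroSet p l) fun x => (zeroMult p l x : ℝ≥0∞) * s.indicator 1 x,
    tsum_eq_sum (s := Z)]
  · refine Finset.sum_congr rfl fun x hx => ?_
    obtain ⟨hxs, hx0⟩ := (hZ x).1 hx
    simp [hxs, hx0]
  · intro x hx
    by_cases hx0 : x ∈ zeroSet p l
    · have : x ∉ s := fun h => hx ((hZ x).2 ⟨h, hx0⟩)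
      simp [this]
    · simp [hx0]

lemma zeroMult_ne_zero {n : ℕ} {p : MvPolynomial (Fin n) ℂ} {l : Fin n → ℝ} {x : ℝ}
    (hx : x ∈ zeroSet p l) : zeroMult p l x ≠ 0 :=
  analyticOrderAt_ne_zero.2 ⟨(differentiable_expPoly p l).analyticAt _, hx⟩

lemma zeroMeasure_singleton_ne_zero_iff {n : ℕ} {p : MvPolynomial (Fin n) ℂ} {l : Fin n → ℝ}
    {x : ℝ} : zeroMeasure p l {x} ≠ 0 ↔ x ∈ zeroSet p l := by
  by_cases hx : x ∈ zeroSet p l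
  · rw [zeroMeasure_eq_sum (measurableSet_singleton x) (Z := {x}) fun y => by
      simp only [Finset.mem_singleton, Set.mem_singleton_iff]
      exact ⟨fun h => ⟨h, h ▸ hx⟩, fun h => h.1⟩]
    simp [hx, zeroMult_ne_zero hx]
  · rw [zeroMeasure_eq_sum (measurableSet_singleton x) (Z := ∅) fun y => by
      simp only [Finset.notMem_empty, Set.mem_singleton_iff, false_iff, not_and]
      rintro rfl
      exact hx]
    simp [hx]

theorem mainTheorem4 (n : ℕ) (d : Fin n → ℕ) (p : MvPolynomial (Fin n) ℂ) (hp : p ∈ LY n d)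
    (l : Fin n → ℝ) (hl : ∀ j, 0 < l j) :
    (∃ err : ℝ → ℝ → ℝ,
      ∀ x T : ℝ, 0 < T →
        zeroMeasure p l (Set.Icc x (x + T)) ≠ ∞ ∧
        (zeroMeasure p l (Set.Icc x (x + T))).toReal =
          (∑ j, (d j : ℝ) * l j) / (2 * Real.pi) * T + err x T ∧
        |err x T| ≤ ∑ j, (d j : ℝ)) ∧
    (∀ x y : ℝ, ConsecutiveAtoms (zeroMeasure p l) x y →
      y - x ≤ 2 * Real.pi * (∑ j, (d j : ℝ)) / (∑ j, (d j : ℝ) * l j)) := by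
  have hpi := Real.pi_pos
  constructor
  · refine ⟨fun x T => (zeroMeasure p l (Set.Icc x (x + T))).toReal -
      (∑ j, (d j : ℝ) * l j) / (2 * Real.pi) * T, fun x T hT => ?_⟩
    obtain ⟨Z, hZ, hcount⟩ :=
      exists_finset_zeroSet_abs_count_sub_le hp hl (lt_add_of_pos_right x hT)
    have hmult : ∀ z : ℝ, (zeroMult p l z : ℝ≥0∞) = ((zeroMult p l z).toNat : ℝ≥0∞) := by
      intro z
      have hz : zeroMult p l z ≠ ⊤ := analyticOrderAt_expPoly_ne_top hp hl (z : ℂ)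
      conv_lhs => rw [← ENat.natCast_toNat hz]
      simp
    have hμ : zeroMeasure p l (Set.Icc x (x + T)) =
        ((∑ z ∈ Z, (zeroMult p l z).toNat : ℕ) : ℝ≥0∞) := by
      rw [zeroMeasure_eq_sum measurableSet_Icc hZ, Nat.cast_sum]
      exact Finset.sum_congr rfl fun z _ => hmult z
    refine ⟨by rw [hμ]; exact ENNReal.natCast_ne_top _, by ring, ?_⟩
    beta_reduce
    rw [hμ, ENNReal.toReal_natCast, Nat.cast_sum]
    rw [add_sub_cancel_left] at hcount
    refine le_of_mul_le_mul_left ?_ (show 0 < 2 * Real.pi by positivity)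
    refine le_trans (le_of_eq ?_) hcount
    rw [← abs_of_pos (show 0 < 2 * Real.pi by positivity), ← abs_mul,
      abs_of_pos (show 0 < 2 * Real.pi by positivity)]
    congr 1
    field_simp
  · rintro x y ⟨hxy, hx, -, hgap⟩
    have hx0 := zeroMeasure_singleton_ne_zero_iff.1 hx
    have hL0 : 0 ≤ ∑ j, (d j : ℝ) * l j :=
      Finset.sum_nonneg fun j _ => mul_nonneg (Nat.cast_nonneg _) (hl j).le
    -- If `⟨d, ℓ⟩ = 0`, then `d = 0` and the error bound excludes any atom.
    have hL : 0 < ∑ j, (d j : ℝ) * l j := by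
      refine lt_of_le_of_ne hL0 fun h => ?_
      have hd : ∀ j, (d j : ℝ) = 0 := fun j =>
        (mul_eq_zero.1 ((Finset.sum_eq_zero_iff_of_nonneg fun j _ =>
          mul_nonneg (Nat.cast_nonneg (d j)) (hl j).le).1 h.symm j (Finset.mem_univ j))).resolve_right
          (hl j).ne'
      obtain ⟨Z, hZ, hcount⟩ := exists_finset_zeroSet_abs_count_sub_le hp hl (lt_add_one x)
      rw [← h, Finset.sum_eq_zero fun j _ => hd j, zero_mul, sub_zero, mul_zero] at hcount
      have hxZ : x ∈ Z := (hZ x).2 ⟨⟨le_rfl, by linarith⟩, hx0⟩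
      have h1 : (1 : ℝ) ≤ (zeroMult p l x).toNat := by
        have h2 : (zeroMult p l x).toNat ≠ 0 := by
          rw [Ne, ENat.toNat_eq_zero]
          exact not_or.2 ⟨zeroMult_ne_zero hx0, analyticOrderAt_expPoly_ne_top hp hl (x : ℂ)⟩
        exact_mod_cast Nat.one_le_iff_ne_zero.2 h2
      have h3 := Finset.single_le_sum (f := fun z => ((zeroMult p l z).toNat : ℝ))
        (fun z _ => Nat.cast_nonneg _) hxZ
      have h4 := (abs_le.1 hcount).2
      nlinarith
    rw [le_div_iff₀ hL]
    have hε : ∀ᶠ ε : ℝ in nhdsWithin 0 (Set.Ioi 0),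
        (∑ j, (d j : ℝ) * l j) * ((y - ε) - (x + ε)) ≤ 2 * Real.pi * ∑ j, (d j : ℝ) := by
      have h1 : ∀ᶠ ε : ℝ in nhdsWithin 0 (Set.Ioi 0), ε < (y - x) / 2 :=
        nhdsWithin_le_nhds (gt_mem_nhds (by linarith))
      filter_upwards [h1, self_mem_nhdsWithin] with ε h1 h0
      have h0 : 0 < ε := h0
      obtain ⟨Z, hZ, hcount⟩ := exists_finset_zeroSet_abs_count_sub_le hp hl
        (show x + ε < y - ε by linarith)
      have hZe : Z = ∅ := Finset.eq_empty_of_forall_notMem fun t ht => by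
        obtain ⟨⟨h2, h3⟩, h4⟩ := (hZ t).1 ht
        exact zeroMeasure_singleton_ne_zero_iff.2 h4
          (hgap t ⟨by linarith, by linarith⟩)
      rw [hZe, Finset.sum_empty, mul_zero, zero_sub, abs_neg] at hcount
      exact (le_abs_self _).trans hcount
    have hlim : Filter.Tendsto (fun ε : ℝ => (∑ j, (d j : ℝ) * l j) * ((y - ε) - (x + ε)))
        (nhdsWithin 0 (Set.Ioi 0)) (nhds ((∑ j, (d j : ℝ) * l j) * (y - x))) := by
      have : Continuous fun ε : ℝ => (∑ j, (d j : ℝ) * l j) * ((y - ε) - (x + ε)) := by fun_prop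
      simpa using (this.tendsto 0).mono_left nhdsWithin_le_nhds
    rw [mul_comm]
    exact le_of_tendsto hlim hε
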